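/- Let $p$ be a prime and $n$ a positive integer, let $\|\xi\|_p=\max_i|\xi_i|_p$ on $\mathbb{Q}_p^n$, and let $d^nx$ be the Haar measure on $\mathbb{Q}_p^n$ with $\mathrm{vol}(\mathbb{Z}_p^n)=1$. Let $\chi_p(y)=e^{2\pi i\{y\}_p}$, where $\{y\}_p$ is the $p$-adic fractional part, and let $\xi\cdot x=\sum_i\xi_ix_i$, $(\mathcal{F}\varphi)(\xi)=\int_{\mathbb{Q}_p^n}\chi_p(\xi\cdot x)\varphi(x)\,d^nx$, $(\mathcal{F}^{-1}\psi)(x)=\int_{\mathbb{Q}_p^n}\chi_p(-\xi\cdot x)\psi(\xi)\,d^n\xi$. Let $A_\beta:\mathbb{Q}_p^n\to[0,\infty)$ be a radial function (that is, $A_\beta(\xi)$ depends only on $\|\xi\|_p$) such that, for some constants $\beta,C_0,C_1>0$, $C_0\|\xi\|_p^\beta\le A_\beta(\xi)\le C_1\|\xi\|_p^\beta$ for all $\xi\in\mathbb{Q}_p^n$. Let $\mathcal{L}_0(\mathbb{Z}_p^n)$ be the space of locally constant, compactly supported functions $\varphi:\mathbb{Q}_p^n\to\mathbb{C}$ with support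 in $\mathbb{Z}_p^n$ and $(\mathcal{F}\varphi)(0)=0$, and let $\boldsymbol{A}_\beta$ be the operator $\boldsymbol{A}_\beta\varphi=\mathcal{F}^{-1}[A_\beta\,\mathcal{F}\varphi]$ with domain $\mathrm{Dom}(\boldsymbol{A}_\beta)=\mathcal{L}_0(\mathbb{Z}_p^n)$, which is given the graph norm $\|\varphi\|_{L^2}+\|\boldsymbol{A}_\beta\varphi\|_{L^2}$. Let $L^2_0(\mathbb{Z}_p^n)$ be the space of $f\in L^2(\mathbb{Z}_p^n)$ with $\int_{\mathbb{Z}_p^n}f\,d^nx=0$, regarded as a subspace of $L^2(\mathbb{Q}_p^n)$ through extension by zero. For $t>0$ and $x\in\mathbb{Q}_p^n$ put $$K(x,t)=\int_{\mathbb{Q}_p^n\setminus\mathbb{Z}_p^n}\chi_p(-x\cdot\xi)\,e^{-tA_\beta(\xi)}\,d^n\xi,$$ and put $T(0)f=f$ and $T(t)f=K(\cdot,t)*f$ for $t>0$. Then for every $\varphi\in\mathcal{L}_0(\mathbb{Z}_p^n)$ the initial value problem $$u\in C\bigl([0,\infty),\mathrm{Dom}(\boldsymbol{A}_\beta)\bigr)\cap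 C^1\bigl([0,\infty),L^2_0(\mathbb{Z}_p^n)\bigr),\qquad \frac{\partial u}{\partial t}+\boldsymbol{A}_\beta u=0\ \ (t\in[0,\infty)),\qquad u(\cdot,0)=\varphi,$$ has a unique solution, and it is given by $u(x,t)=(T(t)\varphi)(x)$. -/

import Mathlib

open MeasureTheory Filter Topology Set

noncomputable section

namespace PadicHeat

/-- `ℚ_p` carries its Borel σ-algebra. -/
instance instMeasurableSpacePadic (p : ℕ) [Fact p.Prime] : MeasurableSpace ℚ_[p] := borel ℚ_[p]

instance instBorelSpacePadic (p : ℕ) [Fact p.Prime] : BorelSpace ℚ_[p] := ⟨rfl⟩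

/-- Multiplying `x` by `p ^ k`, with `k = max (-ord x) 0`, gives a `p`-adic integer. -/
theorem norm_pow_mul_le_one (p : ℕ) [Fact p.Prime] (x : ℚ_[p]) :
    ‖(p : ℚ_[p]) ^ (-x.valuation).toNat * x‖ ≤ 1 := by
  by_cases hx : x = 0
  · simp [hx]
  · have hp : (1 : ℝ) < p := by exact_mod_cast (Fact.out : p.Prime).one_lt
    rw [norm_mul, norm_pow, Padic.norm_p, Padic.norm_eq_zpow_neg_valuation hx, inv_pow,
      ← zpow_natCast, ← zpow_neg, ← zpow_add₀ (by positivity)]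
    apply zpow_le_one_of_nonpos₀ hp.le
    have := Int.self_le_toNat (-x.valuation)
    linarith

/-- The fractional part `{x}_p = p ^ ord x * ∑_{j < -ord x} x_j p ^ j`. The natural number
`PadicInt.appr z k` is the sum of the first `k` terms of the `p`-adic expansion of `z`; for
`ord x ≥ 0` (and for `x = 0`) we have `k = 0` and the value is `0`. -/
def fractPart (p : ℕ) [Fact p.Prime] (x : ℚ_[p]) : ℚ :=
  (PadicInt.appr (⟨(p : ℚ_[p]) ^ (-x.valuation).toNat * x, norm_pow_mul_le_one p x⟩ : ℤ_[p])
    (-x.valuation).toNat : ℚ) / (p : ℚ) ^ (-x.valuation).toNat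

/-- The standard additive character `χ_p(y) = exp (2πi {y}_p)` of `ℚ_p`. -/
def chi (p : ℕ) [Fact p.Prime] (y : ℚ_[p]) : ℂ :=
  Complex.exp (2 * (Real.pi : ℂ) * Complex.I * ((fractPart p y : ℚ) : ℂ))

/-- The unit ball `ℤ_p^n` in `ℚ_p^n`; the norm on `Fin n → ℚ_[p]` is the maximum norm. -/
def unitBall (p : ℕ) [Fact p.Prime] (n : ℕ) : Set (Fin n → ℚ_[p]) := Metric.closedBall 0 1

/-- The unit ball as a compact set with non-empty interior. -/
def unitBallCompacts (p : ℕ) [Fact p.Prime] (n : ℕ) :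
    TopologicalSpace.PositiveCompacts (Fin n → ℚ_[p]) where
  carrier := unitBall p n
  isCompact' := isCompact_closedBall 0 1
  interior_nonempty' :=
    ⟨0, Metric.ball_subset_interior_closedBall (Metric.mem_ball_self one_pos)⟩

/-- The Haar measure `d^n x` on `ℚ_p^n` for which `ℤ_p^n` has volume `1`. -/
def haarQ (p : ℕ) [Fact p.Prime] (n : ℕ) : Measure (Fin n → ℚ_[p]) :=
  Measure.addHaarMeasure (unitBallCompacts p n)

/-- The Fourier transform `(ℱ φ)(ξ) = ∫ χ_p(ξ · x) φ(x) d^n x`. -/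
def fourier (p : ℕ) [Fact p.Prime] {n : ℕ} (φ : (Fin n → ℚ_[p]) → ℂ) (ξ : Fin n → ℚ_[p]) : ℂ :=
  ∫ x, chi p (ξ ⬝ᵥ x) * φ x ∂(haarQ p n)

/-- The inverse Fourier transform `(ℱ⁻¹ ψ)(x) = ∫ χ_p(-ξ · x) ψ(ξ) d^n ξ`. -/
def fourierInv (p : ℕ) [Fact p.Prime] {n : ℕ} (ψ : (Fin n → ℚ_[p]) → ℂ)
    (x : Fin n → ℚ_[p]) : ℂ :=
  ∫ ξ, chi p (-(ξ ⬝ᵥ x)) * ψ ξ ∂(haarQ p n)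

/-- A symbol of order `β`: a non-negative radial function on `ℚ_p^n` comparable to
`‖ξ‖_p ^ β`, for some `β > 0`. -/
structure IsSymbol (p : ℕ) [Fact p.Prime] (n : ℕ) (β : ℝ) (A : (Fin n → ℚ_[p]) → ℝ) : Prop where
  beta_pos : 0 < β
  nonneg : ∀ ξ, 0 ≤ A ξ
  radial : ∃ g : ℝ → ℝ, ∀ ξ, A ξ = g ‖ξ‖
  bounds : ∃ C₀ C₁ : ℝ, 0 < C₀ ∧ 0 < C₁ ∧
    ∀ ξ, C₀ * ‖ξ‖ ^ β ≤ A ξ ∧ A ξ ≤ C₁ * ‖ξ‖ ^ β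

/-- The pseudodifferential operator with symbol `A`: `𝐀 φ = ℱ⁻¹ [A · ℱ φ]`. -/
def pseudoDiff (p : ℕ) [Fact p.Prime] {n : ℕ} (A : (Fin n → ℚ_[p]) → ℝ)
    (φ : (Fin n → ℚ_[p]) → ℂ) : (Fin n → ℚ_[p]) → ℂ :=
  fourierInv p (fun ξ => (A ξ : ℂ) * fourier p φ ξ)

/-- Membership in the Lizorkin space `𝓛₀(ℤ_p^n)`: locally constant functions with compact
support (Bruhat-Schwartz functions) on `ℚ_p^n` whose Fourier transform vanishes at `0` and which
are supported in the unit ball. This is the domain of the operator `𝐀`. -/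
structure IsLizorkin (p : ℕ) [Fact p.Prime] {n : ℕ} (φ : (Fin n → ℚ_[p]) → ℂ) : Prop where
  locallyConstant : IsLocallyConstant φ
  compactSupport : HasCompactSupport φ
  fourier_zero : fourier p φ 0 = 0
  support_subset : Function.support φ ⊆ unitBall p n

/-- Square integrable functions vanishing off the unit ball are integrable. -/
theorem integrable_of_memLp_unitBall (p : ℕ) [Fact p.Prime] (n : ℕ) (f : (Fin n → ℚ_[p]) → ℂ)
    (hf : MemLp f 2 (haarQ p n)) (h0 : ∀ᵐ x ∂(haarQ p n), x ∉ unitBall p n → f x = 0) :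
    Integrable f (haarQ p n) := by
  have hB : MeasurableSet (unitBall p n) := Metric.isClosed_closedBall.measurableSet
  have hfin : haarQ p n (unitBall p n) ≠ ⊤ := by
    have : haarQ p n (unitBall p n) = 1 :=
      Measure.addHaarMeasure_self (K₀ := unitBallCompacts p n)
    simp [this]
  have hae : f =ᵐ[haarQ p n] (unitBall p n).indicator f := by
    filter_upwards [h0] with x hx
    by_cases hxB : x ∈ unitBall p n
    · simp [hxB]
    · simp [hxB, hx hxB]
  have h1 : MemLp ((unitBall p n).indicator f) 1 (haarQ p n) :=
    (hf.indicator hB).mono_exponent_of_measure_support_ne_top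
      (s := unitBall p n) (fun x hx => by simp [hx]) hfin (by norm_num)
  exact (memLp_one_iff_integrable.mp h1).congr hae.symm

/-- The Hilbert space `L²₀(ℤ_p^n)` of square integrable functions on `ℤ_p^n` with integral zero,
its elements being extended by zero to `ℚ_p^n`. -/
def L2Zero (p : ℕ) [Fact p.Prime] (n : ℕ) : Submodule ℂ (Lp ℂ 2 (haarQ p n)) where
  carrier := {f | (∀ᵐ x ∂(haarQ p n), x ∉ unitBall p n → f x = 0) ∧ ∫ x, f x ∂(haarQ p n) = 0}
  zero_mem' := by
    have h := Lp.coeFn_zero ℂ 2 (haarQ p n)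
    refine ⟨?_, ?_⟩
    · filter_upwards [h] with x hx _
      simpa using hx
    · rw [integral_congr_ae h]
      simp
  add_mem' := by
    rintro f g ⟨hf, hf'⟩ ⟨hg, hg'⟩
    have h := Lp.coeFn_add f g
    refine ⟨?_, ?_⟩
    · filter_upwards [h, hf, hg] with x hx h1 h2 hxB
      rw [hx, Pi.add_apply, h1 hxB, h2 hxB, add_zero]
    · rw [integral_congr_ae h]
      have := integral_add (integrable_of_memLp_unitBall p n f (Lp.memLp f) hf)
        (integrable_of_memLp_unitBall p n g (Lp.memLp g) hg)
      simp only [Pi.add_apply]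
      rw [this, hf', hg', add_zero]
  smul_mem' := by
    rintro c f ⟨hf, hf'⟩
    have h := Lp.coeFn_smul c f
    refine ⟨?_, ?_⟩
    · filter_upwards [h, hf] with x hx h1 hxB
      rw [hx, Pi.smul_apply, h1 hxB, smul_zero]
    · rw [integral_congr_ae h]
      simp only [Pi.smul_apply]
      rw [integral_smul, hf', smul_zero]

/-- The graph norm `‖f‖_{L²} + ‖𝐀 f‖_{L²}` of the domain of `𝐀`. -/
def graphNorm (p : ℕ) [Fact p.Prime] {n : ℕ} (A : (Fin n → ℚ_[p]) → ℝ)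
    (f : (Fin n → ℚ_[p]) → ℂ) : ENNReal :=
  eLpNorm f 2 (haarQ p n) + eLpNorm (pseudoDiff p A f) 2 (haarQ p n)

/-- `u` solves `∂u/∂t + 𝐀 u = 0` on `[0, ∞)`, `u(0) = φ`, in the class
`C([0, ∞), Dom 𝐀) ∩ C¹([0, ∞), L²₀(ℤ_p^n))`, where `Dom 𝐀 = 𝓛₀(ℤ_p^n)` has the graph norm.
Only the values `u t` with `t ≥ 0` matter; derivatives at `t = 0` are one-sided. -/
structure IsSolution (p : ℕ) [Fact p.Prime] {n : ℕ} (A : (Fin n → ℚ_[p]) → ℝ)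
    (φ : (Fin n → ℚ_[p]) → ℂ) (u : ℝ → (Fin n → ℚ_[p]) → ℂ) : Prop where
  mem_dom : ∀ t, 0 ≤ t → IsLizorkin p (u t)
  continuous_dom : ∀ t₀, 0 ≤ t₀ →
    Tendsto (fun t => graphNorm p A (u t - u t₀)) (𝓝[Ici 0] t₀) (𝓝 0)
  equation : ∃ U : ℝ → L2Zero p n,
    (∀ t, 0 ≤ t → (U t : Lp ℂ 2 (haarQ p n)) =ᵐ[haarQ p n] u t) ∧
    ContDiffOn ℝ 1 U (Ici 0) ∧
    ∀ t, 0 ≤ t → ∀ᵐ x ∂(haarQ p n),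
      ((derivWithin U (Ici 0) t : L2Zero p n) : Lp ℂ 2 (haarQ p n)) x + pseudoDiff p A (u t) x = 0
  initial : u 0 = φ

/-- The heat kernel `K(x, t) = ∫_{ℚ_p^n \ ℤ_p^n} χ_p(-x · ξ) exp (-t A(ξ)) d^n ξ`. -/
def heatKernel (p : ℕ) [Fact p.Prime] {n : ℕ} (A : (Fin n → ℚ_[p]) → ℝ) (t : ℝ)
    (x : Fin n → ℚ_[p]) : ℂ :=
  ∫ ξ in (unitBall p n)ᶜ, chi p (-(x ⬝ᵥ ξ)) * (Real.exp (-t * A ξ) : ℂ) ∂(haarQ p n)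

/-- `T(0) f = f` and `T(t) f = K(·, t) ∗ f` for `t > 0`. -/
def heatSemigroup (p : ℕ) [Fact p.Prime] {n : ℕ} (A : (Fin n → ℚ_[p]) → ℝ) (t : ℝ)
    (f : (Fin n → ℚ_[p]) → ℂ) : (Fin n → ℚ_[p]) → ℂ :=
  if t = 0 then f
  else convolution (heatKernel p A t) f (ContinuousLinearMap.mul ℂ ℂ) (haarQ p n)

end PadicHeat

end

/-!
A function `φ` of the Lizorkin space is invariant under translations by some ball and supported in
`ℤ_p^n`, so `ℱφ` has compact support and is invariant under translations by `ℤ_p^n`; since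
`ℱφ(0) = 0`, it vanishes on `ℤ_p^n`. Off `ℤ_p^n` the norm, hence every radial function, is
invariant under translations by `ℤ_p^n`. Radial Fourier multipliers therefore preserve the
Lizorkin space (`IsLizorkin.radialMultiplier`), and they act as scalars on the components of `φ`
belonging to the spheres `‖ξ‖ = p ^ (j + 1)`, of which only finitely many occur
(`IsTest.radialMultiplier_eq_sum`). Fourier inversion on test functions
(`IsTest.fourier_fourier`) follows from the multiplication formula and the Fourier transform of
the indicator function of a ball.

The heat kernel is the inverse Fourier transform of the integrable function `exp (-t A)` cut off
to the complement of `ℤ_p^n`, so by Fubini `T(t)` is the multiplier `exp (-t A)`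
(`IsSymbol.heatSemigroup_eq`). Hence `T(t) φ` is a finite sum `∑ exp (-t a_j) φ_j` with
`𝐀 φ_j = a_j φ_j`, which is a solution. Conversely, pairing a solution `v` with a character gives
`y' = -A(ξ) y` for `y = ℱ(v t)(ξ)`, whence `ℱ(v t) = exp (-t A) ℱφ`, and Fourier inversion
determines `v t`.
-/

namespace PadicHeat

/-! ### The standard additive character -/

section Character

variable (p : ℕ) [Fact p.Prime]

theorem exists_fractPart_eq_div (x : ℚ_[p]) :
    ∃ (m : ℤ) (k : ℕ), fractPart p x = (m : ℚ) / (p : ℚ) ^ k :=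
  ⟨_, _, by rw [fractPart, ← Int.cast_natCast]⟩

theorem norm_sub_fractPart_le_one (x : ℚ_[p]) : ‖x - ((fractPart p x : ℚ) : ℚ_[p])‖ ≤ 1 := by
  have hp0 : (p : ℚ_[p]) ≠ 0 := by exact_mod_cast (Fact.out : p.Prime).ne_zero
  set k := (-x.valuation).toNat with hk
  set z : ℤ_[p] := ⟨(p : ℚ_[p]) ^ k * x, norm_pow_mul_le_one p x⟩ with hz
  have h1 : ‖z - (z.appr k : ℤ_[p])‖ ≤ (p : ℝ) ^ (-(k : ℤ)) :=
    (PadicInt.norm_le_pow_iff_mem_span_pow _ _).2 (PadicInt.appr_spec k z)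
  rw [PadicInt.norm_def] at h1
  have h2 : x - ((fractPart p x : ℚ) : ℚ_[p])
      = ((z - (z.appr k : ℤ_[p]) : ℤ_[p]) : ℚ_[p]) / (p : ℚ_[p]) ^ k := by
    have : fractPart p x = (z.appr k : ℚ) / (p : ℚ) ^ k := rfl
    rw [this]
    push_cast
    rw [hz]
    field_simp
  rw [h2, norm_div, norm_pow, Padic.norm_p]
  have hp : (0 : ℝ) < p := by exact_mod_cast (Fact.out : p.Prime).pos
  rw [div_le_one (by positivity)]
  simpa using h1

/-- A rational number whose denominator is a power of `p` and which is a `p`-adic integer is an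
integer. -/
theorem exists_int_eq_of_norm_le_one {m : ℤ} {k : ℕ} {q : ℚ} (hq : q = (m : ℚ) / (p : ℚ) ^ k)
    (h : ‖(q : ℚ_[p])‖ ≤ 1) : ∃ z : ℤ, q = z := by
  have hp : (0 : ℝ) < p := by exact_mod_cast (Fact.out : p.Prime).pos
  have hpq : (p : ℚ) ≠ 0 := by exact_mod_cast (Fact.out : p.Prime).ne_zero
  rw [hq] at h
  push_cast at h
  rw [norm_div, norm_pow, Padic.norm_p, div_le_one (by positivity)] at h
  obtain ⟨z, hz⟩ := (Padic.norm_int_le_pow_iff_dvd m k).1 (by simpa using h)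
  refine ⟨z, ?_⟩
  rw [hq, hz]
  push_cast
  field_simp

theorem exp_two_pi_mul_int (z : ℤ) :
    Complex.exp (2 * (Real.pi : ℂ) * Complex.I * ((z : ℚ) : ℂ)) = 1 :=
  Complex.exp_eq_one_iff.2 ⟨z, by push_cast; ring⟩

theorem chi_add (x y : ℚ_[p]) : chi p (x + y) = chi p x * chi p y := by
  obtain ⟨m₁, k₁, h₁⟩ := exists_fractPart_eq_div p x
  obtain ⟨m₂, k₂, h₂⟩ := exists_fractPart_eq_div p y
  obtain ⟨m₃, k₃, h₃⟩ := exists_fractPart_eq_div p (x + y)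
  have hpq : (p : ℚ) ≠ 0 := by exact_mod_cast (Fact.out : p.Prime).ne_zero
  have hn : ‖((fractPart p (x + y) - (fractPart p x + fractPart p y) : ℚ) : ℚ_[p])‖ ≤ 1 := by
    have e : ((fractPart p (x + y) - (fractPart p x + fractPart p y) : ℚ) : ℚ_[p])
        = ((x - (fractPart p x : ℚ)) + (y - (fractPart p y : ℚ)))
          - ((x + y) - (fractPart p (x + y) : ℚ)) := by
      push_cast; ring
    rw [e, sub_eq_add_neg]
    refine (IsUltrametricDist.norm_add_le_max _ _).trans
      (max_le ?_ ((norm_neg _).trans_le (norm_sub_fractPart_le_one p _)))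
    exact (IsUltrametricDist.norm_add_le_max _ _).trans
      (max_le (norm_sub_fractPart_le_one p _) (norm_sub_fractPart_le_one p _))
  obtain ⟨z, hz⟩ := exists_int_eq_of_norm_le_one p
    (m := m₃ * p ^ (k₁ + k₂) - (m₁ * p ^ (k₂ + k₃) + m₂ * p ^ (k₁ + k₃))) (k := k₁ + k₂ + k₃)
    (by rw [h₁, h₂, h₃]; push_cast; field_simp; ring) hn
  have e : fractPart p (x + y) = fractPart p x + fractPart p y + z := by rw [← hz]; ring
  rw [chi, chi, chi, e, ← Complex.exp_add, Rat.cast_add, mul_add, Complex.exp_add,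
    exp_two_pi_mul_int, mul_one, Rat.cast_add, mul_add]

theorem chi_eq_one_iff (y : ℚ_[p]) : chi p y = 1 ↔ ‖y‖ ≤ 1 := by
  obtain ⟨m, k, h⟩ := exists_fractPart_eq_div p y
  have hy := norm_sub_fractPart_le_one p y
  constructor
  · intro h1
    obtain ⟨z, hz⟩ := Complex.exp_eq_one_iff.1 h1
    have hz' : ((fractPart p y : ℚ) : ℂ) = z := by
      have : (2 * (Real.pi : ℂ) * Complex.I) ≠ 0 := Complex.two_pi_I_ne_zero
      rw [mul_comm] at hz
      exact mul_right_cancel₀ this hz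
    have hz2 : fractPart p y = z := by exact_mod_cast hz'
    rw [hz2] at hy
    have : y = (y - ((z : ℚ) : ℚ_[p])) + ((z : ℚ) : ℚ_[p]) := by ring
    rw [this]
    refine (IsUltrametricDist.norm_add_le_max _ _).trans (max_le hy ?_)
    simpa using Padic.norm_int_le_one z
  · intro h1
    have hf : ‖((fractPart p y : ℚ) : ℚ_[p])‖ ≤ 1 := by
      have : ((fractPart p y : ℚ) : ℚ_[p]) = y - (y - ((fractPart p y : ℚ) : ℚ_[p])) := by ring
      rw [this, sub_eq_add_neg]
      exact (IsUltrametricDist.norm_add_le_max _ _).trans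
        (max_le h1 ((norm_neg _).trans_le hy))
    obtain ⟨z, hz⟩ := exists_int_eq_of_norm_le_one p h hf
    rw [chi, hz, exp_two_pi_mul_int]

theorem chi_zero : chi p 0 = 1 := (chi_eq_one_iff p 0).2 (by simp)

theorem norm_chi (y : ℚ_[p]) : ‖chi p y‖ = 1 := by
  have : chi p y = Complex.exp (((2 * Real.pi * (fractPart p y : ℚ) : ℝ) : ℂ) * Complex.I) := by
    rw [chi]; congr 1; push_cast; ring
  rw [this, Complex.norm_exp_ofReal_mul_I]

theorem continuous_chi : Continuous (chi p) := by
  refine continuous_iff_continuousAt.2 fun y => ?_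
  have : chi p =ᶠ[𝓝 y] fun _ => chi p y := by
    filter_upwards [Metric.ball_mem_nhds y one_pos] with z hz
    have hz1 : ‖z - y‖ ≤ 1 := by
      rw [← dist_eq_norm]; exact (Metric.mem_ball.1 hz).le
    have e : chi p (y + (z - y)) = chi p y * chi p (z - y) := chi_add p _ _
    rwa [(chi_eq_one_iff p _).2 hz1, mul_one, add_sub_cancel] at e
  exact (continuousAt_const).congr this.symm

end Character

section DotProduct

variable {p : ℕ} [Fact p.Prime] {n : ℕ}

theorem norm_dotProduct_le (x y : Fin n → ℚ_[p]) : ‖x ⬝ᵥ y‖ ≤ ‖x‖ * ‖y‖ := by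
  refine IsUltrametricDist.norm_sum_le_of_forall_le_of_nonneg (by positivity) fun i _ => ?_
  rw [norm_mul]
  gcongr
  exacts [norm_le_pi_norm x i, norm_le_pi_norm y i]

/-- The ball of radius `‖a‖` and the ball of radius `‖a‖⁻¹` annihilate each other under the
pairing `χ_p(ξ · x)`: beyond the latter, some `x` in the former is paired to a value `≠ 1`. -/
theorem exists_chi_dotProduct_ne_one {a : ℚ_[p]} (ha : a ≠ 0) {ξ : Fin n → ℚ_[p]}
    (hξ : ‖a‖⁻¹ < ‖ξ‖) : ∃ x : Fin n → ℚ_[p], ‖x‖ ≤ ‖a‖ ∧ chi p (ξ ⬝ᵥ x) ≠ 1 := by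
  have ha' : 0 < ‖a‖ := norm_pos_iff.2 ha
  obtain ⟨i, hi⟩ : ∃ i, ‖a‖⁻¹ < ‖ξ i‖ := by
    by_contra! h
    exact absurd ((pi_norm_le_iff_of_nonneg (by positivity)).2 h) (not_le.2 hξ)
  refine ⟨Pi.single i a, by rw [Pi.norm_single], fun h => ?_⟩
  rw [chi_eq_one_iff, dotProduct_single, norm_mul] at h
  rw [inv_lt_iff_one_lt_mul₀ ha'] at hi
  linarith [mul_comm ‖a‖ ‖ξ i‖]

theorem chi_dotProduct_eq_one {a : ℚ_[p]} (ha : a ≠ 0) {ξ x : Fin n → ℚ_[p]}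
    (hξ : ‖ξ‖ ≤ ‖a‖⁻¹) (hx : ‖x‖ ≤ ‖a‖) : chi p (ξ ⬝ᵥ x) = 1 := by
  refine (chi_eq_one_iff p _).2 ((norm_dotProduct_le ξ x).trans ?_)
  calc ‖ξ‖ * ‖x‖ ≤ ‖a‖⁻¹ * ‖a‖ := by gcongr
    _ = 1 := inv_mul_cancel₀ (norm_ne_zero_iff.2 ha)

theorem norm_add_le_of_le {r : ℝ} {x h : Fin n → ℚ_[p]} (hx : ‖x‖ ≤ r) (hh : ‖h‖ ≤ r) :
    ‖x + h‖ ≤ r :=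
  (IsUltrametricDist.norm_add_le_max _ _).trans (max_le hx hh)

theorem norm_add_le_iff {r : ℝ} {x h : Fin n → ℚ_[p]} (hh : ‖h‖ ≤ r) :
    ‖x + h‖ ≤ r ↔ ‖x‖ ≤ r :=
  ⟨fun hx => by simpa using norm_add_le_of_le hx ((norm_neg h).trans_le hh),
    fun hx => norm_add_le_of_le hx hh⟩

end DotProduct

/-! ### Fourier inversion on test functions -/

section Fourier

variable {p : ℕ} [Fact p.Prime] {n : ℕ}

instance : (haarQ p n).IsAddHaarMeasure := by unfold haarQ; infer_instance

theorem haarQ_unitBall : haarQ p n (unitBall p n) = 1 :=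
  Measure.addHaarMeasure_self (K₀ := unitBallCompacts p n)

theorem continuous_chi_dotProduct (ξ : Fin n → ℚ_[p]) :
    Continuous fun x : Fin n → ℚ_[p] => chi p (ξ ⬝ᵥ x) :=
  (continuous_chi p).comp (continuous_const.dotProduct continuous_id)

theorem continuous_chi_dotProduct_prod :
    Continuous fun z : (Fin n → ℚ_[p]) × (Fin n → ℚ_[p]) => chi p (z.1 ⬝ᵥ z.2) :=
  (continuous_chi p).comp (continuous_fst.dotProduct continuous_snd)

theorem Integrable.chi_mul {φ : (Fin n → ℚ_[p]) → ℂ} (hφ : Integrable φ (haarQ p n))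
    (ξ : Fin n → ℚ_[p]) : Integrable (fun x => chi p (ξ ⬝ᵥ x) * φ x) (haarQ p n) :=
  hφ.bdd_mul (c := 1) (continuous_chi_dotProduct ξ).aestronglyMeasurable
    (Eventually.of_forall fun _ => (norm_chi p _).le)

theorem fourierInv_eq (ψ : (Fin n → ℚ_[p]) → ℂ) (x : Fin n → ℚ_[p]) :
    fourierInv p ψ x = fourier p ψ (-x) := by
  unfold fourierInv fourier
  simp only [dotProduct_neg, dotProduct_comm]

theorem fourier_comp_neg (φ : (Fin n → ℚ_[p]) → ℂ) (ξ : Fin n → ℚ_[p]) :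
    fourier p (fun x => φ (-x)) ξ = fourier p φ (-ξ) := by
  unfold fourier
  rw [← integral_neg_eq_self]
  simp

/-- The multiplication formula `∫ ψ · ℱφ = ∫ ℱψ · φ`. -/
theorem integral_mul_fourier {φ ψ : (Fin n → ℚ_[p]) → ℂ} (hφ : Integrable φ (haarQ p n))
    (hψ : Integrable ψ (haarQ p n)) :
    ∫ ξ, ψ ξ * fourier p φ ξ ∂(haarQ p n) = ∫ x, fourier p ψ x * φ x ∂(haarQ p n) := by
  unfold fourier
  simp_rw [← integral_const_mul, ← integral_mul_const]
  rw [integral_integral_swap]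
  · simp only [dotProduct_comm]
    congr 1; ext x; congr 1; ext y; ring
  · have h := (hψ.mul_prod hφ).bdd_mul (c := 1)
      (continuous_chi_dotProduct_prod (p := p) (n := n)).aestronglyMeasurable
      (Eventually.of_forall fun _ => (norm_chi p _).le)
    refine h.congr (Eventually.of_forall fun z => ?_)
    simp only [Function.uncurry]
    ring

/-- The test functions supported in the ball of radius `‖a‖` and invariant under translations
by the ball of radius `‖b‖`. Both radii are norms of scalars, so that the Fourier transform
exchanges them with the inverse scalars. -/
structure IsTest (a b : ℚ_[p]) (φ : (Fin n → ℚ_[p]) → ℂ) : Prop where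
  eq_zero : ∀ x, ‖a‖ < ‖x‖ → φ x = 0
  add_eq : ∀ x h, ‖h‖ ≤ ‖b‖ → φ (x + h) = φ x

namespace IsTest

variable {a b : ℚ_[p]} {φ ψ : (Fin n → ℚ_[p]) → ℂ}

theorem isLocallyConstant (h : IsTest a b φ) (hb : b ≠ 0) : IsLocallyConstant φ := by
  refine (IsLocallyConstant.iff_eventually_eq φ).2 fun x => ?_
  filter_upwards [Metric.ball_mem_nhds x (norm_pos_iff.2 hb)] with y hy
  have := h.add_eq x (y - x) (by rw [← dist_eq_norm]; exact (Metric.mem_ball.1 hy).le)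
  rwa [add_sub_cancel] at this

theorem hasCompactSupport (h : IsTest a b φ) : HasCompactSupport φ :=
  HasCompactSupport.intro (isCompact_closedBall 0 ‖a‖) fun x hx => h.eq_zero x (by
    simpa using hx)

theorem continuous (h : IsTest a b φ) (hb : b ≠ 0) : Continuous φ :=
  (h.isLocallyConstant hb).continuous

theorem integrable (h : IsTest a b φ) (hb : b ≠ 0) : Integrable φ (haarQ p n) :=
  (h.continuous hb).integrable_of_hasCompactSupport h.hasCompactSupport

theorem memLp (h : IsTest a b φ) (hb : b ≠ 0) : MemLp φ 2 (haarQ p n) :=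
  (h.continuous hb).memLp_of_hasCompactSupport h.hasCompactSupport

theorem comp_neg (h : IsTest a b φ) : IsTest a b fun x => φ (-x) :=
  ⟨fun x hx => h.eq_zero _ (by rwa [norm_neg]), fun x y hy => by
    rw [neg_add]; exact h.add_eq _ _ (by rwa [norm_neg])⟩

theorem fourier (h : IsTest a b φ) (ha : a ≠ 0) (hb : b ≠ 0) :
    IsTest b⁻¹ a⁻¹ (PadicHeat.fourier p φ) := by
  constructor
  · intro ξ hξ
    rw [norm_inv] at hξ
    obtain ⟨y, hy, hy1⟩ := exists_chi_dotProduct_ne_one hb hξ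
    -- translating by `y` multiplies the integral by a constant different from `1`
    have e : PadicHeat.fourier p φ ξ = chi p (ξ ⬝ᵥ y) * PadicHeat.fourier p φ ξ := by
      conv_lhs => rw [PadicHeat.fourier, ← integral_add_right_eq_self _ y]
      rw [PadicHeat.fourier, ← integral_const_mul]
      congr 1; ext x
      rw [h.add_eq x y hy, dotProduct_add, chi_add]
      ring
    have e' : (1 - chi p (ξ ⬝ᵥ y)) * PadicHeat.fourier p φ ξ = 0 := by
      rw [sub_mul, one_mul, ← e, sub_self]
    exact (mul_eq_zero.1 e').resolve_left (sub_ne_zero.2 (Ne.symm hy1))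
  · intro ξ η hη
    rw [norm_inv] at hη
    unfold PadicHeat.fourier
    congr 1; ext x
    rcases le_or_gt ‖x‖ ‖a‖ with hx | hx
    · rw [add_dotProduct, chi_add, chi_dotProduct_eq_one ha hη hx, mul_one]
    · rw [h.eq_zero x hx, mul_zero, mul_zero]

theorem fourierInv (h : IsTest a b φ) (ha : a ≠ 0) (hb : b ≠ 0) :
    IsTest b⁻¹ a⁻¹ (PadicHeat.fourierInv p φ) := by
  rw [show PadicHeat.fourierInv p φ = fun x => PadicHeat.fourier p φ (-x) from
    funext (fourierInv_eq φ)]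
  exact (h.fourier ha hb).comp_neg

end IsTest

theorem integral_indicator_closedBall (r : ℝ) :
    ∫ x, (Metric.closedBall (0 : Fin n → ℚ_[p]) r).indicator (1 : (Fin n → ℚ_[p]) → ℂ) x
      ∂(haarQ p n) = ((haarQ p n).real (Metric.closedBall 0 r) : ℂ) := by
  rw [integral_indicator Metric.isClosed_closedBall.measurableSet]
  simp

theorem isTest_indicator_closedBall {a b : ℚ_[p]} (hab : ‖b‖ ≤ ‖a‖) :
    IsTest a b ((Metric.closedBall (0 : Fin n → ℚ_[p]) ‖a‖).indicator 1) := by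
  constructor
  · intro x hx
    exact indicator_of_notMem (by simpa using hx) _
  · intro x h hh
    have : x + h ∈ Metric.closedBall (0 : Fin n → ℚ_[p]) ‖a‖ ↔
        x ∈ Metric.closedBall (0 : Fin n → ℚ_[p]) ‖a‖ := by
      rw [mem_closedBall_zero_iff, mem_closedBall_zero_iff, norm_add_le_iff (hh.trans hab)]
    by_cases hx : x ∈ Metric.closedBall (0 : Fin n → ℚ_[p]) ‖a‖
    · rw [indicator_of_mem hx, indicator_of_mem (this.2 hx), Pi.one_apply, Pi.one_apply]
    · rw [indicator_of_notMem hx, indicator_of_notMem (mt this.1 hx)]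

/-- The Fourier transform of the indicator function of a ball. -/
theorem fourier_indicator_closedBall {a : ℚ_[p]} (ha : a ≠ 0) :
    fourier p ((Metric.closedBall (0 : Fin n → ℚ_[p]) ‖a‖).indicator 1)
      = (Metric.closedBall (0 : Fin n → ℚ_[p]) ‖a⁻¹‖).indicator
          fun _ => ((haarQ p n).real (Metric.closedBall 0 ‖a‖) : ℂ) := by
  ext ξ
  by_cases hξ : ξ ∈ Metric.closedBall (0 : Fin n → ℚ_[p]) ‖a⁻¹‖
  · rw [indicator_of_mem hξ]
    rw [mem_closedBall_zero_iff, norm_inv] at hξ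
    have : ∀ x, chi p (ξ ⬝ᵥ x) * (Metric.closedBall (0 : Fin n → ℚ_[p]) ‖a‖).indicator 1 x
        = (Metric.closedBall (0 : Fin n → ℚ_[p]) ‖a‖).indicator (1 : (Fin n → ℚ_[p]) → ℂ) x := by
      intro x
      by_cases hx : x ∈ Metric.closedBall (0 : Fin n → ℚ_[p]) ‖a‖
      · rw [chi_dotProduct_eq_one ha hξ (mem_closedBall_zero_iff.1 hx), one_mul]
      · rw [indicator_of_notMem hx, mul_zero]
    simp only [fourier, this]
    rw [integral_indicator_closedBall]
  · rw [indicator_of_notMem hξ]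
    exact ((isTest_indicator_closedBall le_rfl).fourier ha ha).eq_zero ξ (by simpa using hξ)

/-- Fourier inversion up to the volume of two dual balls. -/
theorem IsTest.fourier_fourier_eq_mul {a b : ℚ_[p]} {φ : (Fin n → ℚ_[p]) → ℂ} (h : IsTest a b φ)
    (ha : a ≠ 0) (hb : b ≠ 0) (x : Fin n → ℚ_[p]) :
    PadicHeat.fourier p (PadicHeat.fourier p φ) x
      = ((haarQ p n).real (Metric.closedBall 0 ‖b⁻¹‖) : ℂ)
        * ((haarQ p n).real (Metric.closedBall 0 ‖b‖) : ℂ) * φ (-x) := by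
  set B := (Metric.closedBall (0 : Fin n → ℚ_[p]) ‖b⁻¹‖).indicator (1 : (Fin n → ℚ_[p]) → ℂ) with hB
  have hb' : b⁻¹ ≠ 0 := inv_ne_zero hb
  have hBi : Integrable B (haarQ p n) := (isTest_indicator_closedBall le_rfl).integrable hb'
  -- `ℱφ` lives on the ball dual to the periods of `φ`, so the indicator may be inserted
  have h1 : PadicHeat.fourier p (PadicHeat.fourier p φ) x
      = ∫ ξ, (chi p (x ⬝ᵥ ξ) * B ξ) * PadicHeat.fourier p φ ξ ∂(haarQ p n) := by
    conv_lhs => rw [PadicHeat.fourier]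
    congr 1; ext ξ
    by_cases hξ : ξ ∈ Metric.closedBall (0 : Fin n → ℚ_[p]) ‖b⁻¹‖
    · rw [hB, indicator_of_mem hξ, Pi.one_apply, mul_one]
    · rw [(h.fourier ha hb).eq_zero ξ (by simpa using hξ), mul_zero, mul_zero]
  rw [h1, integral_mul_fourier (h.integrable hb) (Integrable.chi_mul hBi x)]
  have h2 : ∀ y, PadicHeat.fourier p (fun ξ => chi p (x ⬝ᵥ ξ) * B ξ) y
      = PadicHeat.fourier p B (y + x) := by
    intro y
    unfold PadicHeat.fourier
    congr 1; ext ξ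
    rw [add_dotProduct, chi_add, mul_assoc]
  simp_rw [h2, hB, fourier_indicator_closedBall hb', inv_inv]
  rw [← integral_sub_right_eq_self _ x]
  have h3 : ∀ y, (Metric.closedBall (0 : Fin n → ℚ_[p]) ‖b‖).indicator
        (fun _ => ((haarQ p n).real (Metric.closedBall 0 ‖b⁻¹‖) : ℂ)) (y - x + x) * φ (y - x)
      = ((haarQ p n).real (Metric.closedBall 0 ‖b⁻¹‖) : ℂ) * φ (-x)
        * (Metric.closedBall (0 : Fin n → ℚ_[p]) ‖b‖).indicator 1 y := by
    intro y
    rw [sub_add_cancel]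
    by_cases hy : y ∈ Metric.closedBall (0 : Fin n → ℚ_[p]) ‖b‖
    · rw [indicator_of_mem hy, indicator_of_mem hy, sub_eq_neg_add,
        h.add_eq _ _ (mem_closedBall_zero_iff.1 hy), Pi.one_apply, mul_one]
    · rw [indicator_of_notMem hy, indicator_of_notMem hy, zero_mul, mul_zero]
  simp_rw [h3]
  rw [integral_const_mul, integral_indicator_closedBall]
  ring

/-- Dual balls have inverse volumes. The indicator function of `ℤ_p^n` is its own Fourier
transform, and this determines the constant in the inversion formula for every period `b`. -/
theorem haarQ_closedBall_inv_mul {b : ℚ_[p]} (hb : b ≠ 0) (hb1 : ‖b‖ ≤ 1) :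
    ((haarQ p n).real (Metric.closedBall 0 ‖b⁻¹‖) : ℂ)
        * ((haarQ p n).real (Metric.closedBall 0 ‖b‖) : ℂ) = 1 := by
  have h := (isTest_indicator_closedBall (n := n) (a := (1 : ℚ_[p])) (b := b)
    (by simpa using hb1)).fourier_fourier_eq_mul one_ne_zero hb 0
  have e : fourier p ((Metric.closedBall (0 : Fin n → ℚ_[p]) ‖(1 : ℚ_[p])‖).indicator 1)
      = (Metric.closedBall (0 : Fin n → ℚ_[p]) ‖(1 : ℚ_[p])‖).indicator 1 := by
    rw [fourier_indicator_closedBall one_ne_zero]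
    have : (haarQ p n).real (Metric.closedBall 0 ‖(1 : ℚ_[p])‖) = 1 := by
      rw [norm_one, Measure.real]
      exact (congrArg ENNReal.toReal haarQ_unitBall).trans ENNReal.toReal_one
    rw [this, inv_one]
    simp [Pi.one_def]
  rw [e, e] at h
  simpa using h.symm

namespace IsTest

variable {a b : ℚ_[p]} {φ : (Fin n → ℚ_[p]) → ℂ}

theorem fourier_fourier (h : IsTest a b φ) (ha : a ≠ 0) (hb : b ≠ 0) (hb1 : ‖b‖ ≤ 1)
    (x : Fin n → ℚ_[p]) : PadicHeat.fourier p (PadicHeat.fourier p φ) x = φ (-x) := by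
  rw [h.fourier_fourier_eq_mul ha hb, haarQ_closedBall_inv_mul hb hb1, one_mul]

theorem fourierInv_fourier (h : IsTest a b φ) (ha : a ≠ 0) (hb : b ≠ 0) (hb1 : ‖b‖ ≤ 1) :
    PadicHeat.fourierInv p (PadicHeat.fourier p φ) = φ := by
  ext x
  rw [fourierInv_eq, h.fourier_fourier ha hb hb1, neg_neg]

theorem fourier_fourierInv (h : IsTest a b φ) (ha : a ≠ 0) (hb : b ≠ 0) (hb1 : ‖b‖ ≤ 1) :
    PadicHeat.fourier p (PadicHeat.fourierInv p φ) = φ := by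
  ext x
  rw [show PadicHeat.fourierInv p φ = fun x => PadicHeat.fourier p φ (-x) from
    funext (fourierInv_eq φ), fourier_comp_neg, h.fourier_fourier ha hb hb1, neg_neg]

end IsTest

end Fourier

/-! ### Radial Fourier multipliers on the Lizorkin space -/

section Multiplier

variable {p : ℕ} [Fact p.Prime] {n : ℕ}

theorem exists_norm_eq_pow {ξ : Fin n → ℚ_[p]} (hξ : 1 < ‖ξ‖) :
    ∃ j : ℕ, ‖ξ‖ = (p : ℝ) ^ (j + 1) := by
  have hp : (1 : ℝ) < p := by exact_mod_cast (Fact.out : p.Prime).one_lt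
  obtain ⟨i, hi⟩ : ∃ i, ‖ξ‖ ≤ ‖ξ i‖ := by
    by_contra! h
    rcases isEmpty_or_nonempty (Fin n) with hn | hn
    · rw [Subsingleton.elim ξ 0, norm_zero] at hξ
      linarith
    · obtain ⟨i, hi⟩ := Finite.exists_max fun i => ‖ξ i‖
      exact absurd ((pi_norm_le_iff_of_nonneg (norm_nonneg _)).2 hi) (not_le.2 (h i))
  have hi' : ‖ξ‖ = ‖ξ i‖ := le_antisymm hi (norm_le_pi_norm ξ i)
  rw [hi'] at hξ ⊢
  have h0 : ξ i ≠ 0 := norm_pos_iff.1 (one_pos.trans hξ)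
  rw [Padic.norm_eq_zpow_neg_valuation h0] at hξ ⊢
  have hv : 0 < -(ξ i).valuation := (one_lt_zpow_iff_right₀ hp).1 hξ
  refine ⟨(-(ξ i).valuation - 1).toNat, ?_⟩
  rw [← zpow_natCast]
  congr 1
  push_cast
  omega

theorem norm_natCast_pow (k : ℕ) : ‖((p : ℚ_[p]) ^ k)⁻¹‖ = (p : ℝ) ^ k := by
  rw [norm_inv, norm_pow, Padic.norm_p, inv_pow, inv_inv]

theorem natCast_pow_ne_zero (k : ℕ) : (p : ℚ_[p]) ^ k ≠ 0 :=
  pow_ne_zero _ (by exact_mod_cast (Fact.out : p.Prime).ne_zero)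

theorem norm_natCast_pow_le_one (k : ℕ) : ‖(p : ℚ_[p]) ^ k‖ ≤ 1 := by
  rw [norm_pow]
  exact pow_le_one₀ (norm_nonneg _) Padic.norm_p_lt_one.le

/-- By compactness, the functions of the Lizorkin space are invariant under translations by some
ball; hence they are test functions. -/
theorem IsLizorkin.exists_isTest {φ : (Fin n → ℚ_[p]) → ℂ} (h : IsLizorkin p φ) :
    ∃ k : ℕ, IsTest 1 ((p : ℚ_[p]) ^ k) φ := by
  obtain ⟨δ, hδ, H⟩ := lebesgue_number_lemma_of_metric (s := unitBall p n)
    (c := fun z : ℂ => φ ⁻¹' {z}) (isCompact_closedBall 0 1)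
    (fun z => h.locallyConstant.isOpen_fiber z) (fun x _ => mem_iUnion.2 ⟨φ x, rfl⟩)
  obtain ⟨k, hk⟩ := exists_pow_lt_of_lt_one hδ (Padic.norm_p_lt_one (p := p))
  rw [← norm_pow] at hk
  have h0 : ∀ x, 1 < ‖x‖ → φ x = 0 := fun x hx => by
    by_contra hne
    have hmem : ‖x‖ ≤ 1 := by simpa [unitBall] using h.support_subset hne
    linarith
  refine ⟨k, fun x hx => h0 x (by simpa using hx), fun x y hy => ?_⟩
  have hy1 : ‖y‖ ≤ 1 := hy.trans (norm_natCast_pow_le_one k)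
  rcases le_or_gt ‖x‖ 1 with hx | hx
  · obtain ⟨z, hz⟩ := H x (by simpa [unitBall] using hx)
    have e1 : φ x = z := hz (Metric.mem_ball_self hδ)
    have e2 : φ (x + y) = z := hz (by simpa using hy.trans_lt hk)
    rw [e1, e2]
  · rw [h0 x hx, h0 (x + y) (not_le.1 fun hc => not_le.2 hx ((norm_add_le_iff hy1).1 hc))]

theorem IsTest.isLizorkin {b : ℚ_[p]} {φ : (Fin n → ℚ_[p]) → ℂ} (h : IsTest 1 b φ) (hb : b ≠ 0)
    (h0 : PadicHeat.fourier p φ 0 = 0) : IsLizorkin p φ where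
  locallyConstant := h.isLocallyConstant hb
  compactSupport := h.hasCompactSupport
  fourier_zero := h0
  support_subset x hx := by
    by_contra hx'
    exact hx (h.eq_zero x (by simpa [unitBall] using hx'))

theorem IsLizorkin.fourier_eq_zero {φ : (Fin n → ℚ_[p]) → ℂ} (h : IsLizorkin p φ)
    {ξ : Fin n → ℚ_[p]} (hξ : ‖ξ‖ ≤ 1) : fourier p φ ξ = 0 := by
  obtain ⟨k, hk⟩ := h.exists_isTest
  have := (hk.fourier one_ne_zero (natCast_pow_ne_zero k)).add_eq 0 ξ (by simpa using hξ)
  rwa [zero_add, h.fourier_zero] at this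

theorem IsLizorkin.integrable {φ : (Fin n → ℚ_[p]) → ℂ} (h : IsLizorkin p φ) :
    Integrable φ (haarQ p n) := by
  obtain ⟨k, hk⟩ := h.exists_isTest
  exact hk.integrable (natCast_pow_ne_zero k)

theorem IsLizorkin.memLp {φ : (Fin n → ℚ_[p]) → ℂ} (h : IsLizorkin p φ) :
    MemLp φ 2 (haarQ p n) := by
  obtain ⟨k, hk⟩ := h.exists_isTest
  exact hk.memLp (natCast_pow_ne_zero k)

theorem IsLizorkin.fourierInv_fourier {φ : (Fin n → ℚ_[p]) → ℂ} (h : IsLizorkin p φ) :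
    fourierInv p (fourier p φ) = φ := by
  obtain ⟨k, hk⟩ := h.exists_isTest
  exact hk.fourierInv_fourier one_ne_zero (natCast_pow_ne_zero k) (norm_natCast_pow_le_one k)

/-- The radial Fourier multiplier `φ ↦ ℱ⁻¹ [g(‖ξ‖) ℱφ]`. -/
noncomputable def radialMultiplier (p : ℕ) [Fact p.Prime] {n : ℕ} (g : ℝ → ℂ)
    (φ : (Fin n → ℚ_[p]) → ℂ) :
    (Fin n → ℚ_[p]) → ℂ :=
  fourierInv p fun ξ => g ‖ξ‖ * fourier p φ ξ

/-- Off the unit ball the norm is invariant under translations by the unit ball, and on the unit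
ball `ℱφ` vanishes: a radial factor does not destroy the periods of `ℱφ`. -/
theorem IsTest.mul_fourier {b : ℚ_[p]} {φ : (Fin n → ℚ_[p]) → ℂ} (h : IsTest 1 b φ) (hb : b ≠ 0)
    (hφ : IsLizorkin p φ) (g : ℝ → ℂ) :
    IsTest b⁻¹ 1 fun ξ => g ‖ξ‖ * PadicHeat.fourier p φ ξ := by
  have hF := h.fourier one_ne_zero hb
  constructor
  · intro ξ hξ
    rw [hF.eq_zero ξ hξ, mul_zero]
  · intro ξ η hη
    rw [norm_one] at hη
    rcases le_or_gt ‖ξ‖ 1 with hξ | hξ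
    · rw [hφ.fourier_eq_zero hξ, hφ.fourier_eq_zero ((norm_add_le_iff hη).2 hξ), mul_zero, mul_zero]
    · rw [hF.add_eq ξ η (by simpa using hη),
        IsUltrametricDist.norm_add_eq_max_of_norm_ne_norm (by linarith : ‖η‖ < ‖ξ‖).ne',
        max_eq_left (hη.trans hξ.le)]

theorem IsTest.radialMultiplier {k : ℕ} {φ : (Fin n → ℚ_[p]) → ℂ}
    (h : IsTest 1 ((p : ℚ_[p]) ^ k) φ) (hφ : IsLizorkin p φ) (g : ℝ → ℂ) :
    IsTest 1 ((p : ℚ_[p]) ^ k) (PadicHeat.radialMultiplier p g φ) := by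
  have := (h.mul_fourier (natCast_pow_ne_zero k) hφ g).fourierInv
    (inv_ne_zero (natCast_pow_ne_zero k)) one_ne_zero
  rwa [inv_one, inv_inv] at this

theorem IsLizorkin.fourier_radialMultiplier {φ : (Fin n → ℚ_[p]) → ℂ} (hφ : IsLizorkin p φ)
    (g : ℝ → ℂ) :
    fourier p (PadicHeat.radialMultiplier p g φ) = fun ξ => g ‖ξ‖ * fourier p φ ξ := by
  obtain ⟨k, hk⟩ := hφ.exists_isTest
  exact (hk.mul_fourier (natCast_pow_ne_zero k) hφ g).fourier_fourierInv
    (inv_ne_zero (natCast_pow_ne_zero k)) one_ne_zero norm_one.le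

theorem IsLizorkin.radialMultiplier {φ : (Fin n → ℚ_[p]) → ℂ} (hφ : IsLizorkin p φ)
    (g : ℝ → ℂ) : IsLizorkin p (PadicHeat.radialMultiplier p g φ) := by
  obtain ⟨k, hk⟩ := hφ.exists_isTest
  refine (hk.radialMultiplier hφ g).isLizorkin (natCast_pow_ne_zero k) ?_
  simp only [hφ.fourier_radialMultiplier, hφ.fourier_zero, mul_zero]

theorem IsLizorkin.radialMultiplier_comp {φ : (Fin n → ℚ_[p]) → ℂ} (hφ : IsLizorkin p φ)
    (g g' : ℝ → ℂ) : PadicHeat.radialMultiplier p g (PadicHeat.radialMultiplier p g' φ)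
      = PadicHeat.radialMultiplier p (fun r => g r * g' r) φ := by
  conv_lhs => rw [PadicHeat.radialMultiplier, hφ.fourier_radialMultiplier]
  simp only [PadicHeat.radialMultiplier, mul_assoc]

/-- The spectral component of `φ` on the frequency sphere `‖ξ‖ = p ^ (j + 1)`. -/
noncomputable def sphereComponent (p : ℕ) [Fact p.Prime] {n : ℕ} (j : ℕ) (φ : (Fin n → ℚ_[p]) → ℂ) :
    (Fin n → ℚ_[p]) → ℂ :=
  radialMultiplier p (indicator {(p : ℝ) ^ (j + 1)} 1) φ

/-- Only finitely many frequency spheres contribute to a function of the Lizorkin space, and a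
radial multiplier acts on each component as a scalar. -/
theorem IsTest.radialMultiplier_eq_sum {k : ℕ} {φ : (Fin n → ℚ_[p]) → ℂ}
    (h : IsTest 1 ((p : ℚ_[p]) ^ k) φ) (hφ : IsLizorkin p φ) (g : ℝ → ℂ) :
    PadicHeat.radialMultiplier p g φ
      = ∑ j ∈ Finset.range k, g ((p : ℝ) ^ (j + 1)) • sphereComponent p j φ := by
  have hp : (1 : ℝ) < p := by exact_mod_cast (Fact.out : p.Prime).one_lt
  have hk := natCast_pow_ne_zero (p := p) k
  ext x
  simp only [PadicHeat.radialMultiplier, sphereComponent, PadicHeat.fourierInv, Finset.sum_apply,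
    Pi.smul_apply, smul_eq_mul, ← integral_const_mul]
  rw [← integral_finsetSum]
  · congr 1; ext ξ
    rcases le_or_gt ‖ξ‖ 1 with hξ | hξ
    · simp [hφ.fourier_eq_zero hξ]
    rcases lt_or_ge ‖((p : ℚ_[p]) ^ k)⁻¹‖ ‖ξ‖ with hξ' | hξ'
    · simp [(h.fourier one_ne_zero hk).eq_zero ξ hξ']
    obtain ⟨j, hj⟩ := exists_norm_eq_pow hξ
    rw [norm_natCast_pow, hj, pow_le_pow_iff_right₀ hp] at hξ'
    rw [Finset.sum_eq_single_of_mem j (Finset.mem_range.2 (by omega)), hj,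
      indicator_of_mem (mem_singleton _), Pi.one_apply]
    · ring
    · intro i _ hij
      rw [hj, indicator_of_notMem]
      · simp
      · rw [mem_singleton_iff]
        exact fun hc => hij (by have := pow_right_injective₀ (by linarith) hp.ne' hc; omega)
  · intro j _
    refine Integrable.const_mul ?_ _
    have := Integrable.chi_mul ((h.mul_fourier hk hφ
      (indicator {(p : ℝ) ^ (j + 1)} 1)).integrable one_ne_zero) (-x)
    simpa only [neg_dotProduct, dotProduct_comm x] using this

end Multiplier

/-! ### The heat kernel -/

section HeatKernel

variable {p : ℕ} [Fact p.Prime] {n : ℕ}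

/-- The volume of the ball of radius `p ^ j` grows at most exponentially in `j`: scaling a finite
cover of the ball of radius `p` by unit balls bounds the ratio of consecutive volumes. -/
theorem exists_haarQ_closedBall_le (p : ℕ) [Fact p.Prime] (n : ℕ) :
    ∃ M : ℝ, 0 < M ∧ ∀ j : ℕ,
      (haarQ p n).real (Metric.closedBall 0 ((p : ℝ) ^ j)) ≤ M ^ j := by
  have hp0 : (p : ℚ_[p]) ≠ 0 := by exact_mod_cast (Fact.out : p.Prime).ne_zero
  have hp : (0 : ℝ) < p := by exact_mod_cast (Fact.out : p.Prime).pos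
  obtain ⟨s, -, hs, hcov⟩ := finite_cover_balls_of_compact
    (isCompact_closedBall (0 : Fin n → ℚ_[p]) (p : ℝ)) one_pos
  have hstep : ∀ j : ℕ, (haarQ p n).real (Metric.closedBall 0 ((p : ℝ) ^ (j + 1)))
      ≤ (hs.toFinset.card + 1) * (haarQ p n).real (Metric.closedBall 0 ((p : ℝ) ^ j)) := by
    intro j
    have hsub : Metric.closedBall (0 : Fin n → ℚ_[p]) ((p : ℝ) ^ (j + 1)) ⊆
        ⋃ c ∈ hs.toFinset, Metric.closedBall (((p : ℚ_[p]) ^ j)⁻¹ • c) ((p : ℝ) ^ j) := by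
      intro x hx
      rw [mem_closedBall_zero_iff] at hx
      have h1 : (p : ℚ_[p]) ^ j • x ∈ Metric.closedBall (0 : Fin n → ℚ_[p]) (p : ℝ) := by
        rw [mem_closedBall_zero_iff, norm_smul, norm_pow, Padic.norm_p, inv_pow,
          inv_mul_le_iff₀ (by positivity), ← pow_succ]
        exact hx
      obtain ⟨c, hc, hxc⟩ := mem_iUnion₂.1 (hcov h1)
      refine mem_iUnion₂.2 ⟨c, hs.mem_toFinset.2 hc, ?_⟩
      rw [Metric.mem_ball, dist_eq_norm] at hxc
      have e : x - ((p : ℚ_[p]) ^ j)⁻¹ • c = ((p : ℚ_[p]) ^ j)⁻¹ • ((p : ℚ_[p]) ^ j • x - c) := by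
        rw [smul_sub, smul_smul, inv_mul_cancel₀ (pow_ne_zero _ hp0), one_smul]
      rw [Metric.mem_closedBall, dist_eq_norm, e, norm_smul, norm_natCast_pow]
      exact mul_le_of_le_one_right (by positivity) hxc.le
    have htr : ∀ c : Fin n → ℚ_[p], (haarQ p n).real (Metric.closedBall c ((p : ℝ) ^ j))
        = (haarQ p n).real (Metric.closedBall 0 ((p : ℝ) ^ j)) := by
      intro c
      have : Metric.closedBall (0 : Fin n → ℚ_[p]) ((p : ℝ) ^ j)
          = (fun x => c + x) ⁻¹' Metric.closedBall c ((p : ℝ) ^ j) := by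
        ext x; simp [dist_eq_norm]
      rw [Measure.real, Measure.real, this, measure_preimage_add]
    calc (haarQ p n).real (Metric.closedBall 0 ((p : ℝ) ^ (j + 1)))
        ≤ (haarQ p n).real (⋃ c ∈ hs.toFinset,
            Metric.closedBall (((p : ℚ_[p]) ^ j)⁻¹ • c) ((p : ℝ) ^ j)) :=
          measureReal_mono hsub
            ((measure_biUnion_lt_top hs.toFinset.finite_toSet fun c _ =>
              (isCompact_closedBall _ _).measure_lt_top).ne)
      _ ≤ ∑ c ∈ hs.toFinset,
            (haarQ p n).real (Metric.closedBall (((p : ℚ_[p]) ^ j)⁻¹ • c) ((p : ℝ) ^ j)) :=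
          measureReal_biUnion_finset_le _ _
      _ = hs.toFinset.card * (haarQ p n).real (Metric.closedBall 0 ((p : ℝ) ^ j)) := by
          simp_rw [htr]; simp
      _ ≤ _ := by gcongr; linarith
  refine ⟨hs.toFinset.card + 1, by positivity, fun j => ?_⟩
  induction j with
  | zero =>
    rw [pow_zero, pow_zero, Measure.real]
    exact (congrArg ENNReal.toReal haarQ_unitBall).le
  | succ j ih =>
    calc _ ≤ _ := hstep j
      _ ≤ (hs.toFinset.card + 1) * (hs.toFinset.card + 1 : ℝ) ^ j := by gcongr
      _ = _ := by ring

/-- An exponential of an exponential beats any exponential growth. -/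
theorem summable_pow_mul_exp_neg {M c q : ℝ} (hM : 0 < M) (hc : 0 < c) (hq : 1 < q) :
    Summable fun j : ℕ => M ^ j * Real.exp (-(c * q ^ j)) := by
  obtain ⟨m, hm⟩ := pow_unbounded_of_one_lt M hq
  have hq0 : 0 < q := one_pos.trans hq
  have hgeo : Summable fun j : ℕ => (m.factorial / c ^ m) * (M / q ^ m) ^ j :=
    (summable_geometric_of_lt_one (by positivity)
      ((div_lt_one (by positivity)).2 hm)).mul_left _
  refine hgeo.of_nonneg_of_le (fun j => by positivity) fun j => ?_
  have h := Real.pow_div_factorial_le_exp (c * q ^ j) (by positivity) m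
  have h2 : Real.exp (-(c * q ^ j)) ≤ m.factorial / (c * q ^ j) ^ m := by
    rw [Real.exp_neg, ← inv_div]
    exact inv_anti₀ (by positivity) h
  calc M ^ j * Real.exp (-(c * q ^ j)) ≤ M ^ j * (m.factorial / (c * q ^ j) ^ m) := by gcongr
    _ = _ := by
      rw [mul_pow, div_pow, ← pow_mul, ← pow_mul, mul_comm j m]
      field_simp

theorem IsSymbol.integrableOn_exp {β : ℝ} {A : (Fin n → ℚ_[p]) → ℝ} (hA : IsSymbol p n β A)
    {t : ℝ} (ht : 0 < t) :
    IntegrableOn (fun ξ => (Real.exp (-t * A ξ) : ℂ)) (unitBall p n)ᶜ (haarQ p n) := by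
  have hp : (1 : ℝ) < p := by exact_mod_cast (Fact.out : p.Prime).one_lt
  have hp0 : (0 : ℝ) < p := by linarith
  obtain ⟨g, hg⟩ := hA.radial
  obtain ⟨C₀, C₁, hC₀, -, hC⟩ := hA.bounds
  have hβ := hA.beta_pos
  obtain ⟨M, hM, hvol⟩ := exists_haarQ_closedBall_le p n
  have hU : (unitBall p n)ᶜ = ⋃ j : ℕ, Metric.sphere (0 : Fin n → ℚ_[p]) ((p : ℝ) ^ (j + 1)) := by
    ext ξ
    simp only [unitBall, mem_compl_iff, mem_closedBall_zero_iff, not_le, mem_iUnion,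
      mem_sphere_zero_iff_norm]
    exact ⟨exists_norm_eq_pow, fun ⟨j, hj⟩ => hj ▸ one_lt_pow₀ hp j.succ_ne_zero⟩
  have hS : ∀ j : ℕ, MeasurableSet (Metric.sphere (0 : Fin n → ℚ_[p]) ((p : ℝ) ^ (j + 1))) :=
    fun j => Metric.isClosed_sphere.measurableSet
  have hfin : ∀ j : ℕ, haarQ p n (Metric.sphere 0 ((p : ℝ) ^ (j + 1))) ≠ ⊤ :=
    fun j => (isCompact_sphere _ _).measure_ne_top
  rw [hU]
  refine integrableOn_iUnion_of_summable_integral_norm (fun j => ?_) ?_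
  · refine (integrableOn_const (C := (Real.exp (-t * g ((p : ℝ) ^ (j + 1))) : ℂ))
      (hfin j)).congr_fun (fun ξ hξ => ?_) (hS j)
    simp only [hg, mem_sphere_zero_iff_norm.1 hξ]
  · have hq : 1 < (p : ℝ) ^ β := Real.one_lt_rpow hp hβ
    have hsum := (summable_nat_add_iff 1).2 (summable_pow_mul_exp_neg hM (mul_pos ht hC₀) hq)
    refine hsum.of_nonneg_of_le (fun j => integral_nonneg fun _ => norm_nonneg _) fun j => ?_
    have hb : ∀ ξ ∈ Metric.sphere (0 : Fin n → ℚ_[p]) ((p : ℝ) ^ (j + 1)),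
        ‖‖(Real.exp (-t * A ξ) : ℂ)‖‖ ≤ Real.exp (-(t * C₀ * ((p : ℝ) ^ β) ^ (j + 1))) := by
      intro ξ hξ
      rw [norm_norm, Complex.norm_real, Real.norm_of_nonneg (Real.exp_pos _).le,
        Real.exp_le_exp]
      have h1 := (hC ξ).1
      rw [mem_sphere_zero_iff_norm.1 hξ, ← Real.rpow_natCast, ← Real.rpow_mul hp0.le,
        mul_comm ((j + 1 : ℕ) : ℝ), Real.rpow_mul hp0.le, Real.rpow_natCast] at h1
      have := mul_le_mul_of_nonneg_left h1 ht.le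
      linarith
    have h2 := norm_setIntegral_le_of_norm_le_const (hfin j).lt_top hb
    rw [Real.norm_of_nonneg (integral_nonneg fun _ => norm_nonneg _)] at h2
    refine h2.trans ?_
    rw [mul_comm]
    gcongr
    exact (measureReal_mono Metric.sphere_subset_closedBall
      (isCompact_closedBall _ _).measure_ne_top).trans (hvol (j + 1))

/-- Convolution with the heat kernel is the Fourier multiplier `exp (-t A)`: the frequencies in
the unit ball, which the kernel omits, do not occur in functions of the Lizorkin space. -/
theorem IsSymbol.heatSemigroup_eq {β : ℝ} {A : (Fin n → ℚ_[p]) → ℝ} (hA : IsSymbol p n β A)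
    {g : ℝ → ℝ} (hg : ∀ ξ, A ξ = g ‖ξ‖) {t : ℝ} (ht : 0 ≤ t) {φ : (Fin n → ℚ_[p]) → ℂ}
    (hφ : IsLizorkin p φ) :
    heatSemigroup p A t φ = radialMultiplier p (fun r => (Real.exp (-t * g r) : ℂ)) φ := by
  rcases ht.eq_or_lt with rfl | ht
  · rw [heatSemigroup, if_pos rfl]
    simp only [radialMultiplier, neg_zero, zero_mul, Real.exp_zero, Complex.ofReal_one, one_mul]
    exact hφ.fourierInv_fourier.symm
  have hB : MeasurableSet (unitBall p n)ᶜ := Metric.isClosed_closedBall.measurableSet.compl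
  set E : (Fin n → ℚ_[p]) → ℂ :=
    (unitBall p n)ᶜ.indicator fun ξ => (Real.exp (-t * A ξ) : ℂ) with hE
  have hEi : Integrable E (haarQ p n) := (integrable_indicator_iff hB).2 (hA.integrableOn_exp ht)
  have hK : ∀ y, heatKernel p A t y = fourier p E (-y) := by
    intro y
    rw [heatKernel, ← integral_indicator hB, fourier]
    congr 1; ext ξ
    by_cases hξ : ξ ∈ (unitBall p n)ᶜ
    · rw [indicator_of_mem hξ, hE, indicator_of_mem hξ, neg_dotProduct]
    · rw [indicator_of_notMem hξ, hE, indicator_of_notMem hξ, mul_zero]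
  ext x
  rw [heatSemigroup, if_neg ht.ne', convolution]
  simp only [ContinuousLinearMap.mul_apply', hK]
  rw [← integral_neg_eq_self]
  simp only [neg_neg, sub_neg_eq_add]
  rw [← integral_mul_fourier (hφ.integrable.comp_add_left x) hEi, radialMultiplier, fourierInv]
  congr 1; ext ξ
  have hF : fourier p (fun y => φ (x + y)) ξ = chi p (-(ξ ⬝ᵥ x)) * fourier p φ ξ := by
    unfold fourier
    rw [← integral_add_left_eq_self (fun y => chi p (ξ ⬝ᵥ y) * φ y) x, ← integral_const_mul]
    congr 1; ext y
    rw [← mul_assoc, ← chi_add, dotProduct_add, neg_add_cancel_left]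
  rw [hF]
  by_cases hξ : ξ ∈ (unitBall p n)ᶜ
  · rw [hE, indicator_of_mem hξ, hg]
    ring
  · have : ‖ξ‖ ≤ 1 := by simpa [unitBall] using hξ
    rw [hφ.fourier_eq_zero this]
    ring

end HeatKernel

/-! ### Passage to the Hilbert space -/

section HilbertSpace

variable {p : ℕ} [Fact p.Prime] {n : ℕ}

/-- A function of the Lizorkin space as an element of `L²₀(ℤ_p^n)`. -/
noncomputable def IsLizorkin.toL2Zero {φ : (Fin n → ℚ_[p]) → ℂ} (h : IsLizorkin p φ) :
    L2Zero p n :=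
  ⟨h.memLp.toLp φ, by
    have hae := h.memLp.coeFn_toLp
    refine ⟨?_, ?_⟩
    · filter_upwards [hae] with x hx hxB
      rw [hx]
      by_contra hne
      exact hxB (h.support_subset hne)
    · rw [integral_congr_ae hae]
      simpa only [fourier, zero_dotProduct, chi_zero, one_mul] using h.fourier_zero⟩

theorem IsLizorkin.coeFn_toL2Zero {φ : (Fin n → ℚ_[p]) → ℂ} (h : IsLizorkin p φ) :
    ((h.toL2Zero : L2Zero p n) : Lp ℂ 2 (haarQ p n)) =ᵐ[haarQ p n] φ :=
  h.memLp.coeFn_toLp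

theorem coeFn_sum_smul {ι : Type*} (s : Finset ι) (c : ι → ℝ) {F : ι → L2Zero p n}
    {f : ι → (Fin n → ℚ_[p]) → ℂ}
    (h : ∀ i, (F i : Lp ℂ 2 (haarQ p n)) =ᵐ[haarQ p n] f i) :
    ((∑ i ∈ s, c i • F i : L2Zero p n) : Lp ℂ 2 (haarQ p n))
      =ᵐ[haarQ p n] ∑ i ∈ s, (c i : ℂ) • f i := by
  classical
  induction s using Finset.induction_on with
  | empty =>
    simp only [Finset.sum_empty, Submodule.coe_zero]
    exact Lp.coeFn_zero ℂ 2 (haarQ p n)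
  | insert i s hi ih =>
    rw [Finset.sum_insert hi, Finset.sum_insert hi]
    have h1 := Lp.coeFn_add ((c i • F i : L2Zero p n) : Lp ℂ 2 (haarQ p n))
      ((∑ i ∈ s, c i • F i : L2Zero p n) : Lp ℂ 2 (haarQ p n))
    have h2 := Lp.coeFn_smul (c i) (F i : Lp ℂ 2 (haarQ p n))
    filter_upwards [h1, h2, ih, h i] with x h1 h2 h3 h4
    rw [Submodule.coe_add, h1, Pi.add_apply, Pi.add_apply, h3]
    congr 1
    refine h2.trans ?_
    rw [Pi.smul_apply, h4, Pi.smul_apply, Complex.real_smul, smul_eq_mul]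

/-- The Fourier coefficient at `ξ` is a continuous functional on `L²₀(ℤ_p^n)`: the inner product
with a character cut off to the unit ball. -/
theorem exists_clm_eq_fourier (ξ : Fin n → ℚ_[p]) :
    ∃ ℓ : L2Zero p n →L[ℝ] ℂ, ∀ f : L2Zero p n,
      ℓ f = fourier p ((f : Lp ℂ 2 (haarQ p n)) : (Fin n → ℚ_[p]) → ℂ) ξ := by
  have hB : MeasurableSet (unitBall p n) := Metric.isClosed_closedBall.measurableSet
  have hm : MemLp ((unitBall p n).indicator fun x => star (chi p (ξ ⬝ᵥ x))) 2 (haarQ p n) := by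
    have hc : MemLp ((unitBall p n).indicator fun _ => (1 : ℝ)) 2 (haarQ p n) :=
      memLp_indicator_const 2 hB 1 (Or.inr (by simp [haarQ_unitBall]))
    refine hc.of_le ((continuous_chi_dotProduct ξ).star.aestronglyMeasurable.indicator hB)
      (Eventually.of_forall fun x => ?_)
    by_cases hx : x ∈ unitBall p n
    · simp [hx, norm_chi]
    · simp [hx]
  refine ⟨((innerSL ℂ (hm.toLp _)).comp (L2Zero p n).subtypeL).restrictScalars ℝ, fun f => ?_⟩
  change inner ℂ (hm.toLp _) (f : Lp ℂ 2 (haarQ p n)) = _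
  rw [L2.inner_def, fourier]
  refine integral_congr_ae ?_
  filter_upwards [hm.coeFn_toLp, f.2.1] with x h1 h2
  rw [h1]
  by_cases hx : x ∈ unitBall p n
  · rw [indicator_of_mem hx, RCLike.inner_apply, starRingEnd_apply, star_star, mul_comm]
  · rw [h2 hx, inner_zero_right, mul_zero]

theorem fourier_congr_ae {f g : (Fin n → ℚ_[p]) → ℂ} (h : f =ᵐ[haarQ p n] g)
    (ξ : Fin n → ℚ_[p]) : fourier p f ξ = fourier p g ξ :=
  integral_congr_ae (h.mono fun x hx => by simp only [hx])

theorem tendsto_eLpNorm_sum_smul {ι : Type*} {s : Finset ι} {l : Filter ℝ} {d : ι → ℝ → ℂ}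
    {f : ι → (Fin n → ℚ_[p]) → ℂ} (hf : ∀ i, MemLp (f i) 2 (haarQ p n))
    (hd : ∀ i, Tendsto (d i) l (𝓝 0)) :
    Tendsto (fun t => eLpNorm (∑ i ∈ s, d i t • f i) 2 (haarQ p n)) l (𝓝 0) := by
  have hlim : Tendsto (fun t => ∑ i ∈ s, ‖d i t‖ₑ * eLpNorm (f i) 2 (haarQ p n)) l
      (𝓝 (∑ _i ∈ s, 0)) := by
    refine tendsto_finsetSum _ fun i _ => ?_
    have h1 : Tendsto (fun t => ‖d i t‖ₑ) l (𝓝 0) := by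
      simpa [Function.comp_def] using (continuous_enorm.tendsto (0 : ℂ)).comp (hd i)
    simpa using ENNReal.Tendsto.mul_const h1 (Or.inr (hf i).eLpNorm_ne_top)
  rw [Finset.sum_const_zero] at hlim
  refine tendsto_of_tendsto_of_tendsto_of_le_of_le tendsto_const_nhds hlim
    (fun _ => zero_le) fun t => ?_
  refine (eLpNorm_sum_le (fun i _ => ((hf i).const_smul _).aestronglyMeasurable)
    one_le_two).trans_eq ?_
  exact Finset.sum_congr rfl fun i _ => eLpNorm_const_smul _ _ _ _

end HilbertSpace

/-! ### The initial value problem -/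

section CauchyProblem

variable {p : ℕ} [Fact p.Prime] {n : ℕ} {β : ℝ} {A : (Fin n → ℚ_[p]) → ℝ}
  {φ : (Fin n → ℚ_[p]) → ℂ}

theorem pseudoDiff_eq_radialMultiplier {g : ℝ → ℝ} (hg : ∀ ξ, A ξ = g ‖ξ‖)
    (φ : (Fin n → ℚ_[p]) → ℂ) :
    pseudoDiff p A φ = radialMultiplier p (fun r => (g r : ℂ)) φ := by
  simp only [pseudoDiff, radialMultiplier, hg]

/-- Existence: on finitely many frequency spheres the equation is a diagonal linear system. -/
theorem IsSymbol.isSolution_heatSemigroup (hA : IsSymbol p n β A) (hφ : IsLizorkin p φ) :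
    IsSolution p A φ fun t => heatSemigroup p A t φ := by
  obtain ⟨g, hg⟩ := hA.radial
  obtain ⟨k, hk⟩ := hφ.exists_isTest
  set e : ℝ → ℝ → ℂ := fun t r => (Real.exp (-t * g r) : ℂ) with he
  have hu : ∀ t, 0 ≤ t → heatSemigroup p A t φ = radialMultiplier p (e t) φ :=
    fun t ht => hA.heatSemigroup_eq hg ht hφ
  have hL : ∀ j, IsLizorkin p (sphereComponent p j φ) := fun j => hφ.radialMultiplier _
  refine ⟨fun t ht => ?_, fun t₀ ht₀ => ?_, ?_, by simp [heatSemigroup]⟩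
  · rw [hu t ht]
    exact hφ.radialMultiplier _
  · have hd : ∀ t, 0 ≤ t → heatSemigroup p A t φ - heatSemigroup p A t₀ φ
        = radialMultiplier p (fun r => e t r - e t₀ r) φ := by
      intro t ht
      rw [hu t ht, hu t₀ ht₀, hk.radialMultiplier_eq_sum hφ, hk.radialMultiplier_eq_sum hφ,
        hk.radialMultiplier_eq_sum hφ, ← Finset.sum_sub_distrib]
      simp only [sub_smul]
    have he0 : ∀ r, Tendsto (fun t => e t r - e t₀ r) (𝓝[Ici 0] t₀) (𝓝 0) := by
      intro r
      have hc : Continuous fun t => e t r - e t₀ r := by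
        simp only [he]; fun_prop
      simpa using (hc.tendsto t₀).mono_left nhdsWithin_le_nhds
    have h1 := tendsto_eLpNorm_sum_smul (s := Finset.range k) (fun j => (hL j).memLp)
      fun j => he0 ((p : ℝ) ^ (j + 1))
    have h2 := tendsto_eLpNorm_sum_smul (s := Finset.range k) (fun j => (hL j).memLp)
      fun j => by
        simpa using (he0 ((p : ℝ) ^ (j + 1))).const_mul (g ((p : ℝ) ^ (j + 1)) : ℂ)
    have h12 := h1.add h2
    rw [add_zero] at h12
    refine h12.congr' ?_
    filter_upwards [self_mem_nhdsWithin] with t ht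
    rw [graphNorm, hd t ht, pseudoDiff_eq_radialMultiplier hg, hφ.radialMultiplier_comp,
      hk.radialMultiplier_eq_sum hφ, hk.radialMultiplier_eq_sum hφ]
  · have hder : ∀ t, HasDerivAt
        (fun t => ∑ j ∈ Finset.range k,
          Real.exp (-t * g ((p : ℝ) ^ (j + 1))) • (hL j).toL2Zero)
        (∑ j ∈ Finset.range k, (Real.exp (-t * g ((p : ℝ) ^ (j + 1)))
          * (-1 * g ((p : ℝ) ^ (j + 1)))) • (hL j).toL2Zero) t := by
      intro t
      refine HasDerivAt.fun_sum fun j _ => ?_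
      have h : HasDerivAt (fun t => Real.exp (-t * g ((p : ℝ) ^ (j + 1))))
          (Real.exp (-t * g ((p : ℝ) ^ (j + 1))) * (-1 * g ((p : ℝ) ^ (j + 1)))) t :=
        (((hasDerivAt_id t).neg).mul_const _).exp
      exact h.smul_const (hL j).toL2Zero
    refine ⟨fun t => ∑ j ∈ Finset.range k,
      Real.exp (-t * g ((p : ℝ) ^ (j + 1))) • (hL j).toL2Zero, fun t ht => ?_, ?_, fun t ht => ?_⟩
    · rw [hu t ht, hk.radialMultiplier_eq_sum hφ]
      exact coeFn_sum_smul _ _ fun j => (hL j).coeFn_toL2Zero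
    · refine ContDiff.contDiffOn (ContDiff.sum fun j _ => ?_)
      exact ((contDiff_neg.mul contDiff_const).exp).smul contDiff_const
    · rw [(hder t).hasDerivWithinAt.derivWithin (uniqueDiffOn_Ici 0 t ht), hu t ht,
        pseudoDiff_eq_radialMultiplier hg, hφ.radialMultiplier_comp,
        hk.radialMultiplier_eq_sum hφ]
      filter_upwards [coeFn_sum_smul (Finset.range k) (fun j =>
        Real.exp (-t * g ((p : ℝ) ^ (j + 1))) * (-1 * g ((p : ℝ) ^ (j + 1))))
        fun j => (hL j).coeFn_toL2Zero] with x hx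
      rw [hx, ← Pi.add_apply, ← Finset.sum_add_distrib, Finset.sum_apply]
      refine Finset.sum_eq_zero fun j _ => ?_
      simp only [he, Pi.add_apply, Pi.smul_apply, smul_eq_mul]
      push_cast
      ring

theorem eq_exp_mul_of_hasDerivWithinAt {y : ℝ → ℂ} {a : ℝ}
    (h : ∀ t, 0 ≤ t → HasDerivWithinAt y (-((a : ℂ) * y t)) (Ici 0) t) {t : ℝ} (ht : 0 ≤ t) :
    y t = (Real.exp (-t * a) : ℂ) * y 0 := by
  have hz : ∀ s ∈ Ici (0 : ℝ), HasDerivWithinAt (fun s => (Real.exp (s * a) : ℂ) * y s) 0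
      (Ici 0) s := by
    intro s hs
    have h1 : HasDerivAt (fun s => (Real.exp (s * a) : ℂ))
        ((Real.exp (s * a) * (1 * a) : ℝ) : ℂ) s :=
      (((hasDerivAt_id s).mul_const a).exp).ofReal_comp
    refine (h1.hasDerivWithinAt.mul (h s hs)).congr_deriv ?_
    push_cast
    ring
  have hconst := (convex_Ici (0 : ℝ)).is_const_of_fderivWithin_eq_zero (𝕜 := ℝ)
    (fun s hs => (hz s hs).differentiableWithinAt)
    (fun s hs => by
      rw [(hz s hs).hasFDerivWithinAt.fderivWithin (uniqueDiffOn_Ici 0 s hs)]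
      ext; simp)
    (mem_Ici.2 ht) (mem_Ici.2 le_rfl)
  simp only [zero_mul, Real.exp_zero, Complex.ofReal_one, one_mul] at hconst
  rw [← hconst, ← mul_assoc, ← Complex.ofReal_mul, ← Real.exp_add]
  simp

/-- Uniqueness: each Fourier coefficient of a solution solves the scalar equation `y' = -A(ξ) y`,
and the solution is recovered from its Fourier transform. -/
theorem IsSolution.eq_heatSemigroup (hA : IsSymbol p n β A) (hφ : IsLizorkin p φ)
    {v : ℝ → (Fin n → ℚ_[p]) → ℂ} (hv : IsSolution p A φ v) {t : ℝ} (ht : 0 ≤ t) :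
    v t = heatSemigroup p A t φ := by
  obtain ⟨g, hg⟩ := hA.radial
  obtain ⟨V, hVv, hV1, hVeq⟩ := hv.equation
  have hF : ∀ ξ, fourier p (v t) ξ = (Real.exp (-t * A ξ) : ℂ) * fourier p φ ξ := by
    intro ξ
    obtain ⟨ℓ, hℓ⟩ := exists_clm_eq_fourier (p := p) ξ
    have hy : ∀ s, 0 ≤ s → ℓ (V s) = fourier p (v s) ξ := fun s hs => by
      rw [hℓ, fourier_congr_ae (hVv s hs)]
    have h := eq_exp_mul_of_hasDerivWithinAt (y := fun s => ℓ (V s)) (a := A ξ) (fun s hs => ?_) ht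
    · rwa [hy t ht, hy 0 le_rfl, hv.initial] at h
    · have hd := (hV1.differentiableOn one_ne_zero s hs).hasDerivWithinAt
      refine (ℓ.hasFDerivAt.comp_hasDerivWithinAt s hd).congr_deriv ?_
      have hneg : ((derivWithin V (Ici 0) s : L2Zero p n) : Lp ℂ 2 (haarQ p n))
          =ᵐ[haarQ p n] fun x => -pseudoDiff p A (v s) x :=
        (hVeq s hs).mono fun x hx => eq_neg_of_add_eq_zero_left hx
      have hpd : fourier p (pseudoDiff p A (v s)) ξ = A ξ * fourier p (v s) ξ := by
        rw [pseudoDiff_eq_radialMultiplier hg, (hv.mem_dom s hs).fourier_radialMultiplier, hg]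
      rw [hℓ, fourier_congr_ae hneg, hy s hs, ← hpd]
      simp only [fourier, mul_neg, integral_neg]
  rw [← (hv.mem_dom t ht).fourierInv_fourier, hA.heatSemigroup_eq hg ht hφ, radialMultiplier]
  congr 1; ext ξ
  rw [hF, hg]

end CauchyProblem

end PadicHeat

theorem theorem1 (p : ℕ) [Fact p.Prime] (n : ℕ) (β : ℝ) (A : (Fin n → ℚ_[p]) → ℝ)
    (hA : PadicHeat.IsSymbol p n β A)
    (φ : (Fin n → ℚ_[p]) → ℂ) (hφ : PadicHeat.IsLizorkin p φ) :
    PadicHeat.IsSolution p A φ (fun t => PadicHeat.heatSemigroup p A t φ) ∧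
      ∀ v : ℝ → (Fin n → ℚ_[p]) → ℂ, PadicHeat.IsSolution p A φ v →
        ∀ t : ℝ, 0 ≤ t → v t = PadicHeat.heatSemigroup p A t φ :=
  ⟨hA.isSolution_heatSemigroup hφ, fun _ hv _ ht => hv.eq_heatSemigroup hA hφ ht⟩
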